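/- **Theorem (Maximum bearing-constrained path length).** Let $0<r_\alpha\le r_\beta$, $0<\theta_\alpha\le\theta_\beta<2\pi$ and $0<s_\alpha\le s_\beta$. *Kinematics.* For $r\in[r_\alpha,r_\beta]$ and $\theta_c\in[\theta_\alpha,\theta_\beta]$, the (left-turning) turn-to-bearing path $H_{r,\theta_c}$ starts at the origin with orientation $0$, follows a circular arc of radius $r$ until its orientation is $\theta_c$, and then continues along the tangent line; as a function of the distance $d$ travelled, $$H_{r,\theta_c}(d)=\begin{cases}\big(r\sin(d/r),\ r-r\cos(d/r)\big), & d\le r\theta_c,\\ \big((d-r\theta_c)\cos\theta_c+r\sin\theta_c,\ (d-r\theta_c)\sin\theta_c-r\cos\theta_c+r\big), & d>r\theta_c.\end{cases}$$ A point $(x,y)$ is *reachable* if there are such $r,\theta_c$, a continuous speed $s$ with values in $[s_\alpha,s_\beta]$, and a time $u>0$ with $H_{r,\theta_c}\big(\int_0^u s(\gamma)\,d\gamma\big)=(x,y)$. The *path lengths* to $(x,y)$ are the numbers $D>0$ such that, for some such $r,\theta_c$, the restriction of $H_{r,\theta_c}$ to $[0,D]$ is a path from $(0,0)$ to $(x,y)$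 parametrized by arc length (so that $D$ is its length). *Notation.* With $\operatorname{atan}_2$ the two-argument arctangent with values in $(-\pi,\pi]$, put $$\theta_m=2\operatorname{atan}_2(y,x),\qquad r_m=\frac{x^2+y^2}{2y},\qquad R(x,y,\theta)=\frac{x\sin\theta-y\cos\theta}{1-\cos\theta},$$ $$L(x,y,\theta,r)=r\theta+\big\lVert(x,y)-r(\sin\theta,1-\cos\theta)\big\rVert ,$$ and, for $r>0$, $$\Theta(x,y,r)=\begin{cases}2\arctan\left(\dfrac{x-\sqrt{x^2-(2r-y)y}}{2r-y}\right)+P(x,y,r), & 2r-y\ne0,\\ 2\arctan\left(\dfrac{y}{2x}\right), & 2r-y=0,\ x>0,\\ \pi, & 2r-y=0,\ x\le0,\end{cases}$$ where $P(x,y,r)=0$ if ($0<x$ and $0<y$) or ($x\le0$ and $2r<y$), and $P(x,y,r)=2\pi$ if ($0\le x$ and $y<0$) or ($x<0$ and $y<2r$). Conditions that involve $r_m$ are understood to fail when $y=0$. *Claim.* For every reachable point $(x,y)$, exactly one of the three conditions in $$d_{\max}(x,y)=\begin{cases}L(x,y,\Theta(x,y,r_\beta),r_\beta), & x^2+y^2>2r_\beta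 y\ \text{ and }\ \Theta(x,y,r_\beta)\le\theta_\beta,\\[2pt] L(x,y,\theta_\beta,R(x,y,\theta_\beta)), & \big(x^2+y^2>2r_\beta y\ \text{ and }\ \theta_\beta<\Theta(x,y,r_\beta)\big)\ \text{ or }\ \big(r_\alpha\le r_m\le r_\beta\ \text{ and }\ \theta_\beta<\theta_m\big),\\[2pt] L(x,y,\theta_m,r_m), & r_\alpha\le r_m\le r_\beta\ \text{ and }\ \theta_m\le\theta_\beta\end{cases}$$ holds, and $d_{\max}(x,y)$ is the maximum, attained, of the path lengths to $(x,y)$. -/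

import Mathlib

open Real Set MeasureTheory

noncomputable section

namespace TurnToBearing

/-- First coordinate, as a function of the distance `d` travelled, of the left-turning
turn-to-bearing path from the origin with initial orientation `0`: a circular arc of radius `r`
up to change of bearing `θc`, then the tangent line. -/
def Hx (r θc d : ℝ) : ℝ :=
  if d ≤ r * θc then r * sin (d / r)
  else (d - r * θc) * cos θc + r * sin θc

/-- Second coordinate of the same path. -/
def Hy (r θc d : ℝ) : ℝ :=
  if d ≤ r * θc then -r * cos (d / r) + r
  else (d - r * θc) * sin θc - r * cos θc + r

/-- Distance travelled up to time `t` with speed profile `s`. -/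
def travelled (s : ℝ → ℝ) (t : ℝ) : ℝ := ∫ γ in (0 : ℝ)..t, s γ

/-- The trajectory: position at time `t` with turn radius `r`, final bearing `θc`, speed `s`. -/
def J (r θc : ℝ) (s : ℝ → ℝ) (t : ℝ) : ℝ × ℝ :=
  (Hx r θc (travelled s t), Hy r θc (travelled s t))

/-- The constraints on the parameters of a trajectory; the speed varies continuously. -/
def Chi (rα rβ θα θβ sα sβ r θc : ℝ) (s : ℝ → ℝ) : Prop :=
  θc ∈ Icc θα θβ ∧ r ∈ Icc rα rβ ∧ Continuous s ∧ ∀ u, s u ∈ Icc sα sβ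

/-- The reachable envelope. -/
def reachable (rα rβ θα θβ sα sβ : ℝ) : Set (ℝ × ℝ) :=
  {p | ∃ (θc r : ℝ) (s : ℝ → ℝ) (u : ℝ),
    Chi rα rβ θα θβ sα sβ r θc s ∧ 0 < u ∧ J r θc s u = p}

/-- `(fx, fy)` is a path parametrized by its arc length, which leads from `p` (at parameter `0`)
to `q` (at parameter `D`); thus `D` is the length of the path from `p` to `q`. -/
structure PathSegment (D : ℝ) (fx fy : ℝ → ℝ) (p q : ℝ × ℝ) : Prop where
  continuousOn_x : ContinuousOn fx (Icc 0 D)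
  continuousOn_y : ContinuousOn fy (Icc 0 D)
  differentiableOn_x : DifferentiableOn ℝ fx (Ioo 0 D)
  differentiableOn_y : DifferentiableOn ℝ fy (Ioo 0 D)
  integrable : IntervalIntegrable (fun a => √(deriv fx a ^ 2 + deriv fy a ^ 2)) volume 0 D
  arc_length : ∀ d ∈ Icc 0 D, ∫ a in (0 : ℝ)..d, √(deriv fx a ^ 2 + deriv fy a ^ 2) = d
  source : (fx 0, fy 0) = p
  target : (fx D, fy D) = q

/-- The lengths of all turn-to-bearing paths, with turn radius in `[rα, rβ]` and final bearing in
`[θα, θβ]`, from the origin to the point `(x, y)`. -/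
def pathLengths (rα rβ θα θβ x y : ℝ) : Set ℝ :=
  {D | 0 < D ∧ ∃ r ∈ Icc rα rβ, ∃ θc ∈ Icc θα θβ,
    PathSegment D (Hx r θc) (Hy r θc) (0, 0) (x, y)}

/-- The two-argument arctangent, with values in `(-π, π]`. -/
def atan2 (y x : ℝ) : ℝ := Complex.arg ⟨x, y⟩

/-- Final orientation of the circular arc from the origin to `(x, y)`. -/
def thetaM (x y : ℝ) : ℝ := 2 * atan2 y x

/-- Radius of the circular arc from the origin to `(x, y)`, where `y ≠ 0`. (For `y = 0` the
value is `0`, which never lies in an interval `[rα, rβ]` with `0 < rα`.) -/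
def rM (x y : ℝ) : ℝ := (x ^ 2 + y ^ 2) / (2 * y)

/-- Length of the path through `(x, y)` with orientation `θ` there and turn radius `r`. -/
def L (x y θ r : ℝ) : ℝ :=
  r * θ + √((x - r * sin θ) ^ 2 + (y - r * (1 - cos θ)) ^ 2)

/-- Turn radius for which the path passes through `(x, y)` with orientation `θ`. -/
def R (x y θ : ℝ) : ℝ := (x * sin θ - y * cos θ) / (1 - cos θ)

/-- Phase correction for left turns `0 < r`. -/
def phase (x y r : ℝ) : ℝ :=
  if (0 < x ∧ 0 < y) ∨ (x ≤ 0 ∧ 2 * r < y) then 0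
  else if (0 ≤ x ∧ y < 0) ∨ (x < 0 ∧ y < 2 * r) then 2 * π
  else 0

/-- Angle of approach to `(x, y)` of the path with turn radius `r`, for left turns `0 < r`. -/
def Theta (x y r : ℝ) : ℝ :=
  if 2 * r - y ≠ 0 then
    2 * arctan ((x - √(x ^ 2 - (2 * r - y) * y)) / (2 * r - y)) + phase x y r
  else if 0 < x then 2 * arctan (y / (2 * x))
  else π

/-- Condition for the first piece of `dMax` (maximum radius). -/
def MaxRadiusCase (rβ θβ x y : ℝ) : Prop :=
  x ^ 2 + y ^ 2 > 2 * rβ * y ∧ Theta x y rβ ≤ θβ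

/-- Condition for the second piece of `dMax` (maximum bearing). -/
def MaxBearingCase (rα rβ θβ x y : ℝ) : Prop :=
  (x ^ 2 + y ^ 2 > 2 * rβ * y ∧ θβ < Theta x y rβ) ∨
    (rα ≤ rM x y ∧ rM x y ≤ rβ ∧ θβ < thetaM x y)

/-- Condition for the third piece of `dMax` (circular arc). -/
def ArcCase (rα rβ θβ x y : ℝ) : Prop :=
  rα ≤ rM x y ∧ rM x y ≤ rβ ∧ thetaM x y ≤ θβ

open Classical in
/-- The three-piece formula for the maximum path length to `(x, y)`; the value `0` stands for
undefined, where none of the three conditions holds. -/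
def dMax (rα rβ θβ x y : ℝ) : ℝ :=
  if MaxRadiusCase rβ θβ x y then L x y (Theta x y rβ) rβ
  else if MaxBearingCase rα rβ θβ x y then L x y θβ (R x y θβ)
  else if ArcCase rα rβ θβ x y then L x y (thetaM x y) (rM x y)
  else 0

end TurnToBearing

end

namespace TurnToBearing

/-! For a fixed endpoint, the bearing `θ` there determines the radius and the signed tangent length
(`point_eq_iff`). With `c = cot (θ / 2)`, which decreases in `θ`, they are `R = x c - y (c² - 1) /
2` and `t = y c - x`, so `dR/dc = -t`. Where `t ≥ 0`, the radius increases with `θ`, and so does the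
length `R θ + t`, whose derivative is `t (θ - sin θ) / (2 sin² (θ / 2))`
(`totalLength_le_totalLength`). A longest path is thus one of largest feasible bearing.

Three bounds can stop the bearing: `R = rβ`, at `Theta`, if the point is outside the circle of
radius `rβ`; `t = 0`, at `thetaM`, if it is not; or `θβ`, if that comes first. Reachability serves
only to provide some feasible bearing. -/

/-- Cotangent of half the angle. -/
noncomputable def cotHalf (θ : ℝ) : ℝ := cos (θ / 2) / sin (θ / 2)

/-- Signed length of the tangent part of the path through `(x, y)` with final bearing `θ`. -/
noncomputable def tangentLength (x y θ : ℝ) : ℝ := y * cotHalf θ - x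

/-- Length of the path through `(x, y)` with final bearing `θ`. -/
noncomputable def totalLength (x y θ : ℝ) : ℝ := R x y θ * θ + tangentLength x y θ

/-! ### Radius and tangent length as functions of the bearing -/

theorem sin_half_pos {θ : ℝ} (h0 : 0 < θ) (h1 : θ < 2 * π) : 0 < sin (θ / 2) :=
  sin_pos_of_pos_of_lt_pi (by linarith) (by linarith)

theorem sin_eq_half (θ : ℝ) : sin θ = 2 * sin (θ / 2) * cos (θ / 2) := by
  rw [← sin_two_mul]; ring_nf

theorem cos_eq_half (θ : ℝ) : cos θ = 1 - 2 * sin (θ / 2) ^ 2 := by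
  have h := cos_two_mul (θ / 2)
  have h' := sin_sq_add_cos_sq (θ / 2)
  rw [show 2 * (θ / 2) = θ by ring] at h
  linarith

theorem R_eq (x y : ℝ) {θ : ℝ} (h0 : 0 < θ) (h1 : θ < 2 * π) :
    R x y θ = x * cotHalf θ - y * (cotHalf θ ^ 2 - 1) / 2 := by
  have hs := sin_half_pos h0 h1
  have h' := sin_sq_add_cos_sq (θ / 2)
  have hc : cos (θ / 2) ^ 2 = 1 - sin (θ / 2) ^ 2 := by linarith
  rw [R, cotHalf, sin_eq_half θ, cos_eq_half θ, div_pow, hc]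
  field_simp
  ring

/-- The equations are linear in `(t, r)` with determinant `cos θ - 1`, nonzero on `(0, 2π)`. The
sign of `t` is not restricted. -/
theorem point_eq_iff {x y r t θ : ℝ} (h0 : 0 < θ) (h1 : θ < 2 * π) :
    (t * cos θ + r * sin θ = x ∧ t * sin θ - r * cos θ + r = y) ↔
      (R x y θ = r ∧ tangentLength x y θ = t) := by
  have hs := sin_half_pos h0 h1
  have h' := sin_sq_add_cos_sq (θ / 2)
  rw [R_eq x y h0 h1, tangentLength, cotHalf, sin_eq_half θ, cos_eq_half θ]
  generalize sin (θ / 2) = s at *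
  generalize cos (θ / 2) = k at *
  have hk : k ^ 2 = 1 - s ^ 2 := by linarith
  constructor
  · rintro ⟨rfl, rfl⟩
    constructor
    · field_simp
      ring_nf
      simp only [show k ^ 3 = k * k ^ 2 by ring, hk]
      ring
    · field_simp
      ring_nf
      simp only [hk]
      ring
  · rintro ⟨rfl, rfl⟩
    constructor
    · field_simp
      ring_nf
      simp only [show k ^ 3 = k * k ^ 2 by ring, hk]
      ring
    · field_simp
      ring_nf
      simp only [hk]
      ring

/-- Power of the point with respect to the turning circle. -/
theorem sq_add_sq_sub_eq (x y : ℝ) {θ : ℝ} (h0 : 0 < θ) (h1 : θ < 2 * π) :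
    x ^ 2 + y ^ 2 - 2 * R x y θ * y = tangentLength x y θ ^ 2 := by
  rw [R_eq x y h0 h1, tangentLength]; ring

theorem L_eq_totalLength {x y θ : ℝ} (h0 : 0 < θ) (h1 : θ < 2 * π)
    (ht : 0 ≤ tangentLength x y θ) : L x y θ (R x y θ) = totalLength x y θ := by
  obtain ⟨hx, hy⟩ := (point_eq_iff (x := x) (y := y) h0 h1).2 ⟨rfl, rfl⟩
  have h' := sin_sq_add_cos_sq θ
  rw [L, totalLength]
  congr 1
  set t := tangentLength x y θ
  rw [show x - R x y θ * sin θ = t * cos θ by linarith,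
    show y - R x y θ * (1 - cos θ) = t * sin θ by linarith,
    show (t * cos θ) ^ 2 + (t * sin θ) ^ 2 = t ^ 2 * (sin θ ^ 2 + cos θ ^ 2) by ring, h', mul_one,
    sqrt_sq ht]

/-! ### Monotonicity in the bearing -/

theorem cotHalf_lt {θ₀ θ₁ : ℝ} (h0 : 0 < θ₀) (h : θ₀ < θ₁) (h1 : θ₁ < 2 * π) :
    cotHalf θ₁ < cotHalf θ₀ := by
  have hs0 := sin_half_pos h0 (h.trans h1)
  have hs1 := sin_half_pos (h0.trans h) h1
  have hd : 0 < sin (θ₁ / 2 - θ₀ / 2) :=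
    sin_pos_of_pos_of_lt_pi (by linarith) (by linarith)
  rw [sin_sub] at hd
  rw [cotHalf, cotHalf, div_lt_div_iff₀ hs1 hs0]
  linarith

theorem cotHalf_le {θ₀ θ₁ : ℝ} (h0 : 0 < θ₀) (h : θ₀ ≤ θ₁) (h1 : θ₁ < 2 * π) :
    cotHalf θ₁ ≤ cotHalf θ₀ := by
  rcases h.eq_or_lt with rfl | h
  · rfl
  · exact (cotHalf_lt h0 h h1).le

/-- The tangent length is affine in the monotone function `cotHalf`, hence monotone for either sign
of `y`. -/
theorem tangentLength_nonneg_of_between {x y θ₀ θ θ₁ : ℝ} (h0 : 0 < θ₀) (h : θ₀ ≤ θ)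
    (h' : θ ≤ θ₁) (h1 : θ₁ < 2 * π) (ht0 : 0 ≤ tangentLength x y θ₀)
    (ht1 : 0 ≤ tangentLength x y θ₁) : 0 ≤ tangentLength x y θ := by
  have a := cotHalf_le h0 h (h'.trans_lt h1)
  have b := cotHalf_le (h0.trans_le h) h' h1
  unfold tangentLength at *
  rcases le_total 0 y with hy | hy <;> nlinarith

/-- As `dR/dc = -t` with `t` affine in `c`, the trapezoidal rule is exact. -/
theorem R_sub_R {x y θ₀ θ₁ : ℝ} (h0 : 0 < θ₀) (h : θ₀ ≤ θ₁) (h1 : θ₁ < 2 * π) :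
    R x y θ₁ - R x y θ₀ = (cotHalf θ₀ - cotHalf θ₁) *
      ((tangentLength x y θ₀ + tangentLength x y θ₁) / 2) := by
  rw [R_eq x y h0 (h.trans_lt h1), R_eq x y (h0.trans_le h) h1, tangentLength, tangentLength]
  ring

theorem R_le_R {x y θ₀ θ₁ : ℝ} (h0 : 0 < θ₀) (h : θ₀ ≤ θ₁) (h1 : θ₁ < 2 * π)
    (ht0 : 0 ≤ tangentLength x y θ₀) (ht1 : 0 ≤ tangentLength x y θ₁) :
    R x y θ₀ ≤ R x y θ₁ := by
  have h2 := R_sub_R (x := x) (y := y) h0 h h1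
  have h3 := cotHalf_le h0 h h1
  have h4 : 0 ≤ R x y θ₁ - R x y θ₀ := by
    rw [h2]
    exact mul_nonneg (by linarith) (by linarith)
  linarith

theorem le_of_R_le_R {x y θ₀ θ₁ : ℝ} (h0' : θ₀ < 2 * π) (h1 : 0 < θ₁)
    (ht0 : 0 ≤ tangentLength x y θ₀) (ht1 : 0 < tangentLength x y θ₁)
    (hR : R x y θ₀ ≤ R x y θ₁) : θ₀ ≤ θ₁ := by
  by_contra! h
  have h2 := R_sub_R (x := x) (y := y) h1 h.le h0'
  have h3 := cotHalf_lt h1 h h0'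
  have h4 : 0 < R x y θ₀ - R x y θ₁ := by
    rw [h2]
    exact mul_pos (by linarith) (by linarith)
  linarith

theorem hasDerivAt_cotHalf {θ : ℝ} (h0 : 0 < θ) (h1 : θ < 2 * π) :
    HasDerivAt cotHalf (-(1 + cotHalf θ ^ 2) / 2) θ := by
  have hs := (sin_half_pos h0 h1).ne'
  have hd : HasDerivAt (fun a : ℝ => a / 2) (1 / 2) θ := (hasDerivAt_id θ).div_const 2
  refine (hd.cos.div hd.sin hs).congr_deriv ?_
  rw [cotHalf]
  field_simp
  ring

theorem hasDerivAt_totalLength (x y : ℝ) {θ : ℝ} (h0 : 0 < θ) (h1 : θ < 2 * π) :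
    HasDerivAt (totalLength x y)
      (tangentLength x y θ * ((1 + cotHalf θ ^ 2) * θ / 2 - cotHalf θ)) θ := by
  have hc := hasDerivAt_cotHalf h0 h1
  have hr := (hc.const_mul x).sub ((((hc.pow 2).sub_const 1).const_mul y).div_const 2)
  have hD := (hr.mul (hasDerivAt_id θ)).add ((hc.const_mul y).sub_const x)
  have he : totalLength x y =ᶠ[nhds θ] fun a =>
      (x * cotHalf a - y * (cotHalf a ^ 2 - 1) / 2) * a + (y * cotHalf a - x) := by
    filter_upwards [Ioo_mem_nhds h0 h1] with a ha
    rw [totalLength, R_eq x y ha.1 ha.2, tangentLength]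
  refine HasDerivAt.congr_of_eventuallyEq ?_ he
  refine hD.congr_deriv ?_
  rw [tangentLength]
  simp
  ring

theorem totalLength_le_totalLength {x y θ₀ θ₁ : ℝ} (h0 : 0 < θ₀) (h : θ₀ ≤ θ₁)
    (h1 : θ₁ < 2 * π) (ht0 : 0 ≤ tangentLength x y θ₀) (ht1 : 0 ≤ tangentLength x y θ₁) :
    totalLength x y θ₀ ≤ totalLength x y θ₁ := by
  have hd : ∀ θ ∈ Icc θ₀ θ₁, HasDerivAt (totalLength x y)
      (tangentLength x y θ * ((1 + cotHalf θ ^ 2) * θ / 2 - cotHalf θ)) θ := fun θ hθ =>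
    hasDerivAt_totalLength x y (h0.trans_le hθ.1) (hθ.2.trans_lt h1)
  refine monotoneOn_of_deriv_nonneg (convex_Icc θ₀ θ₁)
    (fun θ hθ => (hd θ hθ).continuousAt.continuousWithinAt)
    (fun θ hθ => (hd θ (interior_subset hθ)).differentiableAt.differentiableWithinAt)
    (fun θ hθ => ?_) (left_mem_Icc.2 h) (right_mem_Icc.2 h) h
  have hθ := interior_subset hθ
  have hp : 0 < θ := h0.trans_le hθ.1
  rw [(hd θ hθ).deriv]
  refine mul_nonneg (tangentLength_nonneg_of_between h0 hθ.1 hθ.2 h1 ht0 ht1) ?_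
  have hs := sin_half_pos hp (hθ.2.trans_lt h1)
  have h2 := sin_sq_add_cos_sq (θ / 2)
  have h3 := sin_le hp.le
  rw [sin_eq_half] at h3
  -- The numerator is `θ - sin θ`.
  have h4 : (1 + cotHalf θ ^ 2) * θ / 2 - cotHalf θ =
      (θ - 2 * sin (θ / 2) * cos (θ / 2)) / (2 * sin (θ / 2) ^ 2) := by
    rw [cotHalf, div_pow, show cos (θ / 2) ^ 2 = 1 - sin (θ / 2) ^ 2 by linarith]
    field_simp
    ring
  rw [h4]
  exact div_nonneg (by linarith) (by positivity)

/-! ### The extremal bearings in closed form -/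

theorem cotHalf_two_mul_arctan (w : ℝ) : cotHalf (2 * arctan w) = w⁻¹ := by
  rw [cotHalf, mul_div_cancel_left₀ _ two_ne_zero, ← inv_div, ← tan_eq_sin_div_cos, tan_arctan]

theorem cotHalf_add_two_pi (θ : ℝ) : cotHalf (θ + 2 * π) = cotHalf θ := by
  rw [cotHalf, cotHalf, show (θ + 2 * π) / 2 = θ / 2 + π by ring, cos_add_pi, sin_add_pi, neg_div_neg_eq]

theorem Theta_spec_of_cotHalf {x y r θ q : ℝ} (h0 : 0 < θ) (h1 : θ < 2 * π) (hq : 0 < q)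
    (ht : y * cotHalf θ - x = q)
    (hR : (2 * r - y) = (2 * x - y * cotHalf θ) * cotHalf θ) :
    0 < θ ∧ θ < 2 * π ∧ R x y θ = r ∧ 0 < tangentLength x y θ := by
  refine ⟨h0, h1, ?_, by rw [tangentLength]; linarith⟩
  rw [R_eq x y h0 h1]
  linarith

/-- The angle of approach is the bearing of the tangent from a point outside the turning circle. -/
theorem Theta_spec {x y r : ℝ} (hr : 0 < r) (hout : x ^ 2 + y ^ 2 > 2 * r * y)
    (hxy : y = 0 → x < 0) :
    0 < Theta x y r ∧ Theta x y r < 2 * π ∧ R x y (Theta x y r) = r ∧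
      0 < tangentLength x y (Theta x y r) := by
  have hpi := pi_pos
  -- With `w = tan (θ / 2)`, radius `r` means `(2r - y) w² - 2 x w + y = 0`. If `2r = y`, one root
  -- is `y / (2x)` and the other is at infinity, `θ = π`; the sign of `x` decides which has positive
  -- tangent length.
  by_cases h2 : 2 * r - y = 0
  · have hy : 0 < y := by linarith
    have hx0 : x ≠ 0 := by
      rintro rfl
      nlinarith
    rw [Theta, if_neg (not_not.2 h2)]
    split_ifs with hx
    · have hc := cotHalf_two_mul_arctan (y / (2 * x))
      have ha : 0 < arctan (y / (2 * x)) := arctan_pos.2 (by positivity)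
      have hb := arctan_lt_pi_div_two (y / (2 * x))
      refine Theta_spec_of_cotHalf (q := x) (by linarith) (by linarith) hx ?_ ?_
      · rw [hc]
        field_simp
        ring
      · rw [hc, h2]
        field_simp
        ring
    · have hc : cotHalf π = 0 := by simp [cotHalf]
      refine Theta_spec_of_cotHalf (q := -x) hpi (by linarith) ?_ ?_ ?_
      · rcases lt_or_gt_of_ne hx0 with h | h
        · linarith
        · exact absurd h hx
      · rw [hc]; ring
      · rw [hc, h2]; ring
  · rw [Theta, if_pos h2]
    have hD : 0 < x ^ 2 - (2 * r - y) * y := by linarith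
    have hq : 0 < √(x ^ 2 - (2 * r - y) * y) := sqrt_pos.2 hD
    have hqq := sq_sqrt hD.le
    set q := √(x ^ 2 - (2 * r - y) * y)
    set w := (x - q) / (2 * r - y) with hw
    have hw1 : w * (2 * r - y) = x - q := div_mul_cancel₀ _ h2
    -- The root with `-q` is the right one: it gives tangent length `y / w - x = q > 0`; the other
    -- root would give `-q`.
    have hw2 : w * (x + q) = y := by
      rw [hw]
      field_simp
      linarith
    -- `phase` brings `2 arctan w` into `(0, 2π)`. Its default branch is never reached here.
    have hsign : (0 < w ∧ phase x y r = 0) ∨ (w < 0 ∧ phase x y r = 2 * π) := by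
      unfold phase
      split_ifs with ha hb
      · refine Or.inl ⟨?_, rfl⟩
        rcases ha with ⟨hx, hy⟩ | ⟨hx, hy⟩
        · exact pos_of_mul_pos_left (by rw [hw2]; exact hy) (by linarith : 0 ≤ x + q)
        · exact div_pos_of_neg_of_neg (by linarith) (by linarith)
      · refine Or.inr ⟨?_, rfl⟩
        rcases hb with ⟨hx, hy⟩ | ⟨hx, hy⟩
        · by_contra! h
          have := mul_nonneg h (by linarith : 0 ≤ x + q)
          linarith
        · exact div_neg_of_neg_of_pos (by linarith) (by linarith)
      · exfalso
        push Not at ha hb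
        rcases lt_trichotomy x 0 with hx | hx | hx
        · exact h2 (by linarith [ha.2 hx.le, hb.2 hx])
        · subst hx
          have h3 := ha.2 le_rfl
          have h4 := hb.1 le_rfl
          nlinarith
        · have h3 := ha.1 hx
          have h4 := hb.1 hx.le
          linarith [hxy (le_antisymm h3 h4)]
    have hw0 : w ≠ 0 := by
      rcases hsign with h | h
      · exact h.1.ne'
      · exact h.1.ne
    have hb := arctan_lt_pi_div_two w
    have hb' := neg_pi_div_two_lt_arctan w
    have hT : y * w⁻¹ - x = q := by
      rw [← hw2]
      field_simp
      ring
    have hR : 2 * r - y = (2 * x - y * w⁻¹) * w⁻¹ := by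
      rw [show y * w⁻¹ = x + q by linarith, eq_mul_inv_iff_mul_eq₀ hw0]
      linarith
    rcases hsign with ⟨hs, hp⟩ | ⟨hs, hp⟩
    · have ha : 0 < arctan w := arctan_pos.2 hs
      have hc := cotHalf_two_mul_arctan w
      rw [hp, add_zero]
      exact Theta_spec_of_cotHalf (by linarith) (by linarith) hq (by rw [hc, hT])
        (by rw [hc]; exact hR)
    · have ha : arctan w < 0 := arctan_lt_zero.2 hs
      have hc := (cotHalf_add_two_pi (2 * arctan w)).trans (cotHalf_two_mul_arctan w)
      rw [hp]
      exact Theta_spec_of_cotHalf (by linarith) (by linarith) hq (by rw [hc, hT])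
        (by rw [hc]; exact hR)

/-- The circular arc through a point of the upper half plane. -/
theorem thetaM_spec {x y : ℝ} (hy : 0 < y) :
    0 < thetaM x y ∧ thetaM x y < 2 * π ∧ R x y (thetaM x y) = rM x y ∧
      tangentLength x y (thetaM x y) = 0 := by
  have hz : (⟨x, y⟩ : ℂ) ≠ 0 := fun h => hy.ne' (congrArg Complex.im h)
  have hn : ‖(⟨x, y⟩ : ℂ)‖ ≠ 0 := norm_ne_zero_iff.2 hz
  have hc : cotHalf (thetaM x y) = x / y := by
    rw [cotHalf, thetaM, atan2, mul_div_cancel_left₀ _ two_ne_zero, Complex.cos_arg hz,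
      Complex.sin_arg]
    exact div_div_div_cancel_right₀ hn x y
  have h0 : 0 < thetaM x y := by
    have h1 : 0 ≤ atan2 y x := Complex.arg_nonneg_iff.2 hy.le
    have h2 : atan2 y x ≠ 0 := fun h => hy.ne' (Complex.arg_eq_zero_iff.1 h).2
    have h3 := lt_of_le_of_ne h1 h2.symm
    rw [thetaM]
    linarith
  have h1 : thetaM x y < 2 * π := by
    have h1 : atan2 y x ≤ π := Complex.arg_le_pi _
    have h2 : atan2 y x ≠ π := fun h => hy.ne' (Complex.arg_eq_pi_iff.1 h).2
    have h3 := lt_of_le_of_ne h1 h2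
    rw [thetaM]
    linarith
  refine ⟨h0, h1, ?_, ?_⟩
  · rw [R_eq x y h0 h1, hc, rM]
    field_simp
    ring
  · rw [tangentLength, hc]
    field_simp
    ring

/-- For `y > 0` the tangent length strictly decreases in the bearing and vanishes at `thetaM`. -/
theorem le_thetaM {x y θ : ℝ} (hy : 0 < y) (h1 : θ < 2 * π)
    (ht : 0 ≤ tangentLength x y θ) : θ ≤ thetaM x y := by
  obtain ⟨hm0, hm1, -, hm⟩ := thetaM_spec (x := x) hy
  by_contra! h
  have h2 := cotHalf_lt hm0 h h1
  unfold tangentLength at *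
  nlinarith

/-! ### Differentiability and arc length of the path -/

theorem Hx_of_le {r θc d : ℝ} (h : d ≤ r * θc) : Hx r θc d = r * sin (d / r) := if_pos h

theorem Hy_of_le {r θc d : ℝ} (h : d ≤ r * θc) : Hy r θc d = -r * cos (d / r) + r := if_pos h

theorem Hx_of_ge {r θc d : ℝ} (hr : 0 < r) (h : r * θc ≤ d) :
    Hx r θc d = (d - r * θc) * cos θc + r * sin θc := by
  rcases h.eq_or_lt with rfl | h
  · rw [Hx_of_le le_rfl, mul_div_cancel_left₀ _ hr.ne']
    ring
  · exact if_neg h.not_ge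

theorem Hy_of_ge {r θc d : ℝ} (hr : 0 < r) (h : r * θc ≤ d) :
    Hy r θc d = (d - r * θc) * sin θc - r * cos θc + r := by
  rcases h.eq_or_lt with rfl | h
  · rw [Hy_of_le le_rfl, mul_div_cancel_left₀ _ hr.ne']
    ring
  · exact if_neg h.not_ge

theorem hasDerivAt_of_Iic_of_Ici {f g h : ℝ → ℝ} {a b f' : ℝ}
    (hg : ∀ d ≤ a, f d = g d) (hh : ∀ d, a ≤ d → f d = h d)
    (hg' : b ≤ a → HasDerivAt g f' b) (hh' : a ≤ b → HasDerivAt h f' b) :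
    HasDerivAt f f' b := by
  rcases lt_trichotomy b a with hb | rfl | hb
  · refine (hg' hb.le).congr_of_eventuallyEq ?_
    filter_upwards [Iio_mem_nhds hb] with d hd using hg d (le_of_lt hd)
  · have h1 : HasDerivWithinAt f f' (Iic b) b :=
      (hg' le_rfl).hasDerivWithinAt.congr hg (hg b le_rfl)
    have h2 : HasDerivWithinAt f f' (Ici b) b :=
      (hh' le_rfl).hasDerivWithinAt.congr hh (hh b le_rfl)
    have h3 := h1.union h2
    rwa [Iic_union_Ici, hasDerivWithinAt_univ] at h3
  · refine (hh' hb.le).congr_of_eventuallyEq ?_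
    filter_upwards [Ioi_mem_nhds hb] with d hd using hh d (le_of_lt hd)

/-- `min (d / r) θc` is the orientation after distance `d`; arc and line have the same derivative at
the junction. -/
theorem hasDerivAt_Hx {r : ℝ} (hr : 0 < r) (θc d : ℝ) :
    HasDerivAt (Hx r θc) (cos (min (d / r) θc)) d := by
  refine hasDerivAt_of_Iic_of_Ici (fun _ => Hx_of_le) (fun _ => Hx_of_ge hr) (fun h => ?_)
    (fun h => ?_)
  · rw [min_eq_left ((div_le_iff₀' hr).2 h)]
    refine (((hasDerivAt_id d).div_const r).sin.const_mul r).congr_deriv ?_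
    simp only [id]
    field_simp
  · rw [min_eq_right ((le_div_iff₀' hr).2 h)]
    refine ((((hasDerivAt_id d).sub_const (r * θc)).mul_const (cos θc)).add_const
      (r * sin θc)).congr_deriv ?_
    ring

theorem hasDerivAt_Hy {r : ℝ} (hr : 0 < r) (θc d : ℝ) :
    HasDerivAt (Hy r θc) (sin (min (d / r) θc)) d := by
  refine hasDerivAt_of_Iic_of_Ici (fun _ => Hy_of_le) (fun _ => Hy_of_ge hr) (fun h => ?_)
    (fun h => ?_)
  · rw [min_eq_left ((div_le_iff₀' hr).2 h)]
    refine ((((hasDerivAt_id d).div_const r).cos.const_mul (-r)).add_const r).congr_deriv ?_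
    simp only [id]
    field_simp
  · rw [min_eq_right ((le_div_iff₀' hr).2 h)]
    refine (((((hasDerivAt_id d).sub_const (r * θc)).mul_const (sin θc)).sub_const
      (r * cos θc)).add_const r).congr_deriv ?_
    ring

theorem pathSegment_H {r θc : ℝ} (hr : 0 < r) (hθc : 0 < θc) (D : ℝ) :
    PathSegment D (Hx r θc) (Hy r θc) (0, 0) (Hx r θc D, Hy r θc D) := by
  have hx := hasDerivAt_Hx hr θc
  have hy := hasDerivAt_Hy hr θc
  have h1 : (fun a => √(deriv (Hx r θc) a ^ 2 + deriv (Hy r θc) a ^ 2)) = fun _ => 1 := by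
    funext a
    rw [(hx a).deriv, (hy a).deriv, cos_sq_add_sin_sq, sqrt_one]
  refine ⟨fun a _ => (hx a).continuousAt.continuousWithinAt,
    fun a _ => (hy a).continuousAt.continuousWithinAt,
    fun a _ => (hx a).differentiableAt.differentiableWithinAt,
    fun a _ => (hy a).differentiableAt.differentiableWithinAt, ?_, fun d _ => ?_, ?_, rfl⟩
  · rw [h1]
    exact intervalIntegrable_const
  · rw [h1]
    simp
  · rw [Hx_of_le (by positivity), Hy_of_le (by positivity)]
    simp

/-! ### Feasible bearings and path lengths -/

/-- The bearing `θ` at `(x, y)` belongs to a path allowed by the bounds on radius and final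
bearing; the lower bound on the final bearing matters only if the tangent part is nontrivial. -/
structure Feasible (rα rβ θα θβ x y θ : ℝ) : Prop where
  pos : 0 < θ
  le : θ ≤ θβ
  le_R : rα ≤ R x y θ
  R_le : R x y θ ≤ rβ
  nonneg : 0 ≤ tangentLength x y θ
  bearing : θα ≤ θ ∨ tangentLength x y θ = 0

/-- The bearing is `D / r` if the path stops on the arc, and `θc` if it stops on the line. -/
theorem exists_feasible {rα rβ θα θβ r θc D : ℝ} (hrα : 0 < rα) (hθα : 0 < θα)
    (hθβ : θβ < 2 * π) (hr : r ∈ Icc rα rβ) (hθc : θc ∈ Icc θα θβ) (hD : 0 < D) :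
    ∃ θ, Feasible rα rβ θα θβ (Hx r θc D) (Hy r θc D) θ ∧
      totalLength (Hx r θc D) (Hy r θc D) θ = D := by
  have hr0 : 0 < r := hrα.trans_le hr.1
  rcases le_total D (r * θc) with h | h
  · have h1 : D / r ≤ θβ := ((div_le_iff₀' hr0).2 h).trans hθc.2
    have h0 : 0 < D / r := div_pos hD hr0
    obtain ⟨hR, hT⟩ := (point_eq_iff (r := r) (t := 0) (x := Hx r θc D) (y := Hy r θc D) h0
      (h1.trans_lt hθβ)).1 (by rw [Hx_of_le h, Hy_of_le h]; constructor <;> ring)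
    refine ⟨D / r, ⟨h0, h1, hr.1.trans_eq hR.symm, hR.trans_le hr.2, hT.ge, Or.inr hT⟩, ?_⟩
    rw [totalLength, hR, hT, add_zero, mul_div_cancel₀ _ hr0.ne']
  · have h0 : 0 < θc := hθα.trans_le hθc.1
    obtain ⟨hR, hT⟩ := (point_eq_iff (r := r) (t := D - r * θc) (x := Hx r θc D)
      (y := Hy r θc D) h0 (hθc.2.trans_lt hθβ)).1 (by rw [Hx_of_ge hr0 h, Hy_of_ge hr0 h]; simp)
    refine ⟨θc, ⟨h0, hθc.2, hr.1.trans_eq hR.symm, hR.trans_le hr.2,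
      (sub_nonneg.2 h).trans_eq hT.symm, Or.inl hθc.1⟩, ?_⟩
    rw [totalLength, hR, hT, add_sub_cancel]

theorem Feasible.totalLength_mem {rα rβ θα θβ x y θ : ℝ} (h : Feasible rα rβ θα θβ x y θ)
    (hrα : 0 < rα) (hθα : 0 < θα) (hθ : θα ≤ θβ) (hθβ : θβ < 2 * π) :
    totalLength x y θ ∈ pathLengths rα rβ θα θβ x y := by
  obtain ⟨h0, h1, h2, h3, h4, h5⟩ := h
  have hr : 0 < R x y θ := hrα.trans_le h2
  obtain ⟨hx, hy⟩ := (point_eq_iff (x := x) (y := y) h0 (h1.trans_lt hθβ)).2 ⟨rfl, rfl⟩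
  refine ⟨by rw [totalLength]; positivity, R x y θ, ⟨h2, h3⟩, ?_⟩
  rcases h5 with h5 | h5
  · refine ⟨θ, ⟨h5, h1⟩, ?_⟩
    have h6 : R x y θ * θ ≤ totalLength x y θ := by rw [totalLength]; linarith
    convert pathSegment_H hr h0 (totalLength x y θ) using 2
    · rw [Hx_of_ge hr h6, totalLength, add_sub_cancel_left, hx]
    · rw [Hy_of_ge hr h6, totalLength, add_sub_cancel_left, hy]
  -- The endpoint lies on the arc and `θ` may be below `θα`, so the path with final bearing `θβ` is
  -- cut off while still turning.
  · refine ⟨θβ, ⟨hθ, le_rfl⟩, ?_⟩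
    have h7 : totalLength x y θ = R x y θ * θ := by rw [totalLength, h5, add_zero]
    have h6 : totalLength x y θ ≤ R x y θ * θβ := by
      rw [h7]
      exact mul_le_mul_of_nonneg_left h1 hr.le
    rw [h5] at hx hy
    convert pathSegment_H hr (hθα.trans_le hθ) (totalLength x y θ) using 2
    · rw [Hx_of_le h6, h7, mul_div_cancel_left₀ _ hr.ne']
      linarith
    · rw [Hy_of_le h6, h7, mul_div_cancel_left₀ _ hr.ne']
      linarith

theorem isGreatest_pathLengths {rα rβ θα θβ x y θ : ℝ} (h : Feasible rα rβ θα θβ x y θ)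
    (hrα : 0 < rα) (hθα : 0 < θα) (hθ : θα ≤ θβ) (hθβ : θβ < 2 * π)
    (hmax : ∀ θ', Feasible rα rβ θα θβ x y θ' → θ' ≤ θ) :
    IsGreatest (pathLengths rα rβ θα θβ x y) (L x y θ (R x y θ)) := by
  have h1 : θ < 2 * π := h.le.trans_lt hθβ
  rw [L_eq_totalLength h.pos h1 h.nonneg]
  refine ⟨h.totalLength_mem hrα hθα hθ hθβ, ?_⟩
  rintro D ⟨hD, r, hr, θc, hθc, hp⟩
  obtain ⟨θ', hf, hl⟩ := exists_feasible hrα hθα hθβ hr hθc hD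
  have hx : Hx r θc D = x := congrArg Prod.fst hp.target
  have hy : Hy r θc D = y := congrArg Prod.snd hp.target
  rw [hx, hy] at hf hl
  rw [← hl]
  exact totalLength_le_totalLength hf.pos (hmax θ' hf) h1 hf.nonneg h.nonneg

theorem exists_feasible_of_reachable {rα rβ θα θβ sα sβ x y : ℝ} (hrα : 0 < rα) (hθα : 0 < θα)
    (hθβ : θβ < 2 * π) (hsα : 0 < sα) (h : (x, y) ∈ reachable rα rβ θα θβ sα sβ) :
    ∃ θ, Feasible rα rβ θα θβ x y θ := by
  obtain ⟨θc, r, s, u, ⟨hθc, hr, hs, hb⟩, hu, hJ⟩ := h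
  have hx : Hx r θc (travelled s u) = x := congrArg Prod.fst hJ
  have hy : Hy r θc (travelled s u) = y := congrArg Prod.snd hJ
  have hD : 0 < travelled s u :=
    intervalIntegral.intervalIntegral_pos_of_pos (hs.intervalIntegrable 0 u)
      (fun a => hsα.trans_le (hb a).1) hu
  obtain ⟨θ, hf, -⟩ := exists_feasible hrα hθα hθβ hr hθc hD
  exact ⟨θ, hx ▸ hy ▸ hf⟩

/-! ### The three cases -/

theorem inside_of_le_rM {rα rβ x y : ℝ} (hrα : 0 < rα) (h0 : rα ≤ rM x y)
    (h1 : rM x y ≤ rβ) : ¬ x ^ 2 + y ^ 2 > 2 * rβ * y := by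
  have hm : 0 < rM x y := hrα.trans_le h0
  have hy : 0 < y := by
    by_contra! hy
    exact hm.not_ge (div_nonpos_of_nonneg_of_nonpos (by positivity) (by linarith))
  rw [rM, div_le_iff₀ (by positivity)] at h1
  intro h
  linarith

/-- Raising the bearing to `thetaM` increases the radius to `rM`, whence the lower bound; the upper
bound is `hin` itself. -/
theorem Feasible.rM_le {rα rβ θα θβ x y θ : ℝ} (h : Feasible rα rβ θα θβ x y θ)
    (hrα : 0 < rα) (hθβ : θβ < 2 * π) (hin : x ^ 2 + y ^ 2 ≤ 2 * rβ * y) :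
    0 < y ∧ rα ≤ rM x y ∧ rM x y ≤ rβ := by
  obtain ⟨h0, h1, h2, h3, h4, -⟩ := h
  have hy : 0 < y := by
    by_contra! hy
    have h5 : x ^ 2 + y ^ 2 ≤ 0 := hin.trans (mul_nonpos_of_nonneg_of_nonpos (by linarith) hy)
    have hx : x = 0 := by nlinarith
    have hy : y = 0 := by nlinarith
    subst hx hy
    rw [R, zero_mul, zero_mul, sub_zero, zero_div] at h2
    linarith
  obtain ⟨hm0, hm1, hmR, hmT⟩ := thetaM_spec (x := x) hy
  refine ⟨hy, ?_, ?_⟩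
  · have h5 := R_le_R h0 (le_thetaM hy (h1.trans_lt hθβ) h4) hm1 h4 hmT.ge
    linarith
  · rw [rM, div_le_iff₀ (by positivity)]
    linarith

/-- With zero tangent length the point would lie on a turning circle of radius at most `rβ`, hence
not outside the largest one. -/
theorem Feasible.le_of_outside {rα rβ θα θβ x y θ : ℝ} (h : Feasible rα rβ θα θβ x y θ)
    (hrα : 0 < rα) (hθβ : θβ < 2 * π) (hout : x ^ 2 + y ^ 2 > 2 * rβ * y) : θα ≤ θ := by
  obtain ⟨h0, h1, h2, h3, h4, h5 | h5⟩ := h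
  · exact h5
  · exfalso
    have h6 := sq_add_sq_sub_eq x y h0 (h1.trans_lt hθβ)
    rw [h5] at h6
    have hR : 0 < R x y θ := hrα.trans_le h2
    have hy : 0 ≤ y := by
      by_contra! hy
      nlinarith [sq_nonneg x, sq_nonneg y]
    nlinarith

theorem Feasible.x_neg_of_y_eq_zero {rα rβ θα θβ x y θ : ℝ}
    (h : Feasible rα rβ θα θβ x y θ) (hrα : 0 < rα) (hθβ : θβ < 2 * π) (hy : y = 0) :
    x < 0 := by
  have h4 := h.nonneg
  have h2 := h.le_R
  rw [R_eq x y h.pos (h.le.trans_lt hθβ)] at h2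
  rw [tangentLength] at h4
  subst hy
  refine lt_of_le_of_ne (by linarith) ?_
  rintro rfl
  linarith

theorem exists_case_isGreatest {rα rβ θα θβ x y θ₀ : ℝ} (h : Feasible rα rβ θα θβ x y θ₀)
    (hrα : 0 < rα) (hθα : 0 < θα) (hθ : θα ≤ θβ) (hθβ : θβ < 2 * π) :
    (MaxRadiusCase rβ θβ x y ∧
      IsGreatest (pathLengths rα rβ θα θβ x y) (L x y (Theta x y rβ) rβ)) ∨
    (MaxBearingCase rα rβ θβ x y ∧
      IsGreatest (pathLengths rα rβ θα θβ x y) (L x y θβ (R x y θβ))) ∨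
    (ArcCase rα rβ θβ x y ∧
      IsGreatest (pathLengths rα rβ θα θβ x y) (L x y (thetaM x y) (rM x y))) := by
  have hβ : 0 < θβ := hθα.trans_le hθ
  have hr : rα ≤ rβ := h.le_R.trans h.R_le
  rcases lt_or_ge (2 * rβ * y) (x ^ 2 + y ^ 2) with hout | hin
  · obtain ⟨t0, t1, tR, tT⟩ := Theta_spec (hrα.trans_le hr) hout
      (h.x_neg_of_y_eq_zero hrα hθβ)
    have hle : ∀ θ', Feasible rα rβ θα θβ x y θ' → θ' ≤ Theta x y rβ := fun θ' h' =>
      le_of_R_le_R (h'.le.trans_lt hθβ) t0 h'.nonneg tT (by rw [tR]; exact h'.R_le)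
    have hα : θα ≤ θ₀ := h.le_of_outside hrα hθβ hout
    rcases le_or_gt (Theta x y rβ) θβ with hc | hc
    · refine Or.inl ⟨⟨hout, hc⟩, ?_⟩
      have hG := isGreatest_pathLengths ⟨t0, hc, hr.trans_eq tR.symm, tR.le, tT.le,
        Or.inl (hα.trans (hle _ h))⟩ hrα hθα hθ hθβ hle
      rwa [tR] at hG
    · refine Or.inr (Or.inl ⟨Or.inl ⟨hout, hc⟩, ?_⟩)
      -- `θβ` lies between a feasible bearing and `Theta`, so monotonicity of the radius gives both
      -- radius bounds at `θβ`.
      have hT := tangentLength_nonneg_of_between h.pos h.le hc.le t1 h.nonneg tT.le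
      exact isGreatest_pathLengths ⟨hβ, le_rfl,
        h.le_R.trans (R_le_R h.pos h.le hθβ h.nonneg hT),
        (R_le_R hβ hc.le t1 hT tT.le).trans_eq tR, hT, Or.inl hθ⟩ hrα hθα hθ hθβ
        fun _ h' => h'.le
  · obtain ⟨hy, hα, hβM⟩ := h.rM_le hrα hθβ hin
    obtain ⟨m0, m1, mR, mT⟩ := thetaM_spec (x := x) hy
    rcases le_or_gt (thetaM x y) θβ with hc | hc
    · refine Or.inr (Or.inr ⟨⟨hα, hβM, hc⟩, ?_⟩)
      have hG := isGreatest_pathLengths ⟨m0, hc, hα.trans_eq mR.symm, mR.trans_le hβM, mT.ge, Or.inr mT⟩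
        hrα hθα hθ hθβ fun θ' h' => le_thetaM hy (h'.le.trans_lt hθβ) h'.nonneg
      rwa [mR] at hG
    · refine Or.inr (Or.inl ⟨Or.inr ⟨hα, hβM, hc⟩, ?_⟩)
      have hT := tangentLength_nonneg_of_between h.pos h.le hc.le m1 h.nonneg mT.ge
      exact isGreatest_pathLengths ⟨hβ, le_rfl,
        h.le_R.trans (R_le_R h.pos h.le hθβ h.nonneg hT),
        (R_le_R hβ hc.le m1 hT mT.ge).trans (mR.trans_le hβM), hT, Or.inl hθ⟩ hrα hθα hθ hθβ
        fun _ h' => h'.le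

theorem not_maxRadiusCase_and_maxBearingCase {rα rβ θβ x y : ℝ} (hrα : 0 < rα) :
    ¬ (MaxRadiusCase rβ θβ x y ∧ MaxBearingCase rα rβ θβ x y) := by
  rintro ⟨⟨h1, h2⟩, ⟨-, h4⟩ | ⟨h3, h4, -⟩⟩
  · exact h4.not_ge h2
  · exact inside_of_le_rM hrα h3 h4 h1

theorem not_maxRadiusCase_and_arcCase {rα rβ θβ x y : ℝ} (hrα : 0 < rα) :
    ¬ (MaxRadiusCase rβ θβ x y ∧ ArcCase rα rβ θβ x y) := by
  rintro ⟨⟨h1, -⟩, h3, h4, -⟩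
  exact inside_of_le_rM hrα h3 h4 h1

theorem not_maxBearingCase_and_arcCase {rα rβ θβ x y : ℝ} (hrα : 0 < rα) :
    ¬ (MaxBearingCase rα rβ θβ x y ∧ ArcCase rα rβ θβ x y) := by
  rintro ⟨⟨h1, -⟩ | ⟨-, -, h1⟩, h3, h4, h5⟩
  · exact inside_of_le_rM hrα h3 h4 h1
  · exact h1.not_ge h5

end TurnToBearing

theorem mainTheorem2 (rα rβ θα θβ sα sβ x y : ℝ)
    (hrα : 0 < rα) (hr : rα ≤ rβ)
    (hθα : 0 < θα) (hθ : θα ≤ θβ) (hθβ : θβ < 2 * Real.pi)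
    (hsα : 0 < sα) (hs : sα ≤ sβ)
    (hxy : (x, y) ∈ TurnToBearing.reachable rα rβ θα θβ sα sβ) :
    -- exactly one of the three cases of the formula applies
    (TurnToBearing.MaxRadiusCase rβ θβ x y ∨ TurnToBearing.MaxBearingCase rα rβ θβ x y ∨
      TurnToBearing.ArcCase rα rβ θβ x y) ∧
    ¬ (TurnToBearing.MaxRadiusCase rβ θβ x y ∧ TurnToBearing.MaxBearingCase rα rβ θβ x y) ∧
    ¬ (TurnToBearing.MaxRadiusCase rβ θβ x y ∧ TurnToBearing.ArcCase rα rβ θβ x y) ∧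
    ¬ (TurnToBearing.MaxBearingCase rα rβ θβ x y ∧ TurnToBearing.ArcCase rα rβ θβ x y) ∧
    -- and the formula gives the maximum path length, which is attained
    IsGreatest (TurnToBearing.pathLengths rα rβ θα θβ x y)
      (TurnToBearing.dMax rα rβ θβ x y) := by
  obtain ⟨θ₀, h₀⟩ := TurnToBearing.exists_feasible_of_reachable hrα hθα hθβ hsα hxy
  have hRB := TurnToBearing.not_maxRadiusCase_and_maxBearingCase
    (rβ := rβ) (θβ := θβ) (x := x) (y := y) hrα
  have hRA := TurnToBearing.not_maxRadiusCase_and_arcCase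
    (rβ := rβ) (θβ := θβ) (x := x) (y := y) hrα
  have hBA := TurnToBearing.not_maxBearingCase_and_arcCase
    (rβ := rβ) (θβ := θβ) (x := x) (y := y) hrα
  have H := TurnToBearing.exists_case_isGreatest h₀ hrα hθα hθ hθβ
  refine ⟨H.imp And.left (Or.imp And.left And.left), hRB, hRA, hBA, ?_⟩
  rw [TurnToBearing.dMax]
  rcases H with ⟨h, hG⟩ | ⟨h, hG⟩ | ⟨h, hG⟩
  · rwa [if_pos h]
  · rwa [if_neg fun h' => hRB ⟨h', h⟩, if_pos h]
  · rwa [if_neg fun h' => hRA ⟨h', h⟩, if_neg fun h' => hBA ⟨h', h⟩, if_pos h]
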